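/- Let $q$ be a complex number with $0<|q|<1$. Write $[n]_q=\frac{1-q^n}{1-q}$, $(a;p)_n=\prod_{i=0}^{n-1}(1-ap^i)$ and $(a;p)_\infty=\prod_{i=0}^{\infty}(1-ap^i)$ for $|p|<1$. Then the following two series converge absolutely, with the sums shown: $$\sum_{k=0}^{\infty}(-1)^kq^{k^2+2k}\,\frac{[4k+1]_q}{([2k]_q-1)\,[2k+2]_q}\cdot\frac{(q;q^2)_k^3}{(q^2;q^2)_k^3}=-\frac{(q;q^2)_\infty(q^3;q^2)_\infty}{(q^2;q^2)_\infty^2},$$ $$\sum_{k=0}^{\infty}(-1)^kq^{k^2}\,\frac{P(q^{2k})}{(1-q)^2\,[2k+2]_q^2}\cdot\frac{(q;q^2)_k^3}{(q^2;q^2)_k^3}=\frac{(q;q^2)_\infty(q^3;q^2)_\infty}{(q^2;q^2)_\infty^2},$$ where $P(x)=1+(q-2q^2)x-(q+q^2-q^4)x^2+(2q^3-q^4)x^3$. -/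

import Mathlib

/-- The `q`-integer `[n]_q = (1 - q ^ n) / (1 - q)`. -/
noncomputable def qInt (q : ℂ) (n : ℕ) : ℂ := (1 - q ^ n) / (1 - q)

/-- The finite `q`-shifted factorial `(a; q)_n = (1 - a) (1 - a q) ⋯ (1 - a q ^ (n - 1))`. -/
noncomputable def qPoch (a q : ℂ) (n : ℕ) : ℂ := ∏ i ∈ Finset.range n, (1 - a * q ^ i)

/-- The infinite `q`-shifted factorial `(a; q)_∞ = ∏_{i ≥ 0} (1 - a q ^ i)`, for `‖q‖ < 1`. -/
noncomputable def qPochInf (a q : ℂ) : ℂ := ∏' i : ℕ, (1 - a * q ^ i)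

/-- The product defining `(a; q)_∞` converges when `‖q‖ < 1`. -/
theorem multipliable_qPochInf (a : ℂ) {q : ℂ} (hq : ‖q‖ < 1) :
    Multipliable fun i : ℕ => 1 - a * q ^ i := by
  have hs : Summable fun i : ℕ => ‖-(a * q ^ i)‖ := by
    simp only [norm_neg, norm_mul, norm_pow]
    exact (summable_geometric_of_lt_one (norm_nonneg q) hq).mul_left _
  simpa only [sub_eq_add_neg] using multipliable_one_add_of_summable hs

/-- `(a; q)_∞ = (a; q)_n (a q ^ n; q)_∞`: when the last factor is not zero, the finite product is
the quotient `(a; q)_∞ / (a q ^ n; q)_∞`. -/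
theorem qPoch_mul_qPochInf (a : ℂ) {q : ℂ} (hq : ‖q‖ < 1) (n : ℕ) :
    qPoch a q n * qPochInf (a * q ^ n) q = qPochInf a q := by
  induction n with
  | zero => simp [qPoch]
  | succ n ih =>
    rw [← ih, qPoch, Finset.prod_range_succ, ← qPoch, mul_assoc]
    congr 1
    have hm : Multipliable fun i : ℕ => 1 - a * q ^ n * q ^ (i + 1) := by
      have h := multipliable_qPochInf (a * q ^ (n + 1)) hq
      refine h.congr fun i => ?_
      ring
    have h := tprod_eq_zero_mul' (f := fun i : ℕ => 1 - a * q ^ n * q ^ i) hm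
    rw [qPochInf, qPochInf, h, pow_zero, mul_one]
    congr 1
    refine tprod_congr fun i => ?_
    ring

/-- `P(x) = 1 + (q - 2q²) x - (q + q² - q⁴) x² + (2q³ - q⁴) x³`. -/
noncomputable def bauerP (q x : ℂ) : ℂ :=
  1 + (q - 2 * q ^ 2) * x - (q + q ^ 2 - q ^ 4) * x ^ 2 + (2 * q ^ 3 - q ^ 4) * x ^ 3

/-!
Write `t k = (-1)^k q^(k^2) (q; q^2)_k^3 / (q^2; q^2)_k^3` and `x = q^(2k)`.  Both series are
telescoping perturbations of the `q`-analogue of Bauer's series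
`∑ (1 - q x^2) t k = (q; q^2)_∞^2 / (q^2; q^2)_∞^2`: multiplied by `1 - q`, the summand of the first
one is `-(1 - q x^2) t k` minus the difference of `q (1 - x)^2 / (q - x) * t k`, and that of the
second one is `(1 - q x^2) t k` plus the difference of `q (1 - x) * t k`.  The telescoping sequences
vanish at `k = 0` and tend to zero, so they contribute nothing.

The `q`-Bauer series is the case `a = b = c = q`, `d → ∞` of the nonterminating `₆φ₅` sum in base
`q^2`.  It is proved by replacing `a` by `a = q^(2N+1)`, which gives the terms `bauerTerm q N k` and
the sums `S N = ∑ (1 - a x^2) bauerTerm q N k`.  The pair of `bauerTerm_wz` yields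
`(1 - q^(2N+2))^2 S N = (1 - q^(2N+1))^2 S (N + 1)`, hence
`(q^2; q^2)_N^2 S 0 = (q; q^2)_N^2 S N`, and `S N → 1` by dominated convergence.
-/

open Filter Topology

/-! ### Finite and infinite shifted factorials -/

theorem qPoch_succ (a p : ℂ) (n : ℕ) : qPoch a p (n + 1) = qPoch a p n * (1 - a * p ^ n) :=
  Finset.prod_range_succ _ _

theorem one_sub_mul_qPoch_mul (a p : ℂ) (n : ℕ) :
    (1 - a) * qPoch (a * p) p n = qPoch a p n * (1 - a * p ^ n) := by
  rw [← qPoch_succ, qPoch, qPoch, Finset.prod_range_succ', mul_comm, pow_zero, mul_one]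
  congr 1
  exact Finset.prod_congr rfl fun i _ => by ring

theorem norm_qPoch_le {a p : ℂ} (ha : ‖a‖ ≤ 1) (hp : ‖p‖ ≤ 1) (n : ℕ) : ‖qPoch a p n‖ ≤ 2 ^ n := by
  rw [qPoch, norm_prod]
  refine (Finset.prod_le_prod (fun _ _ => norm_nonneg _) (g := fun _ => (2 : ℝ)) fun i _ => ?_).trans
    (by simp)
  have h : ‖a * p ^ i‖ ≤ 1 := by
    rw [norm_mul, norm_pow]
    exact mul_le_one₀ ha (by positivity) (pow_le_one₀ (norm_nonneg _) hp)
  have := norm_sub_le (1 : ℂ) (a * p ^ i)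
  rw [norm_one] at this
  linarith

theorem le_norm_qPoch {a p : ℂ} {r : ℝ} (hr : r ≤ 1) (ha : ‖a‖ ≤ r) (hp : ‖p‖ ≤ 1) (n : ℕ) :
    (1 - r) ^ n ≤ ‖qPoch a p n‖ := by
  rw [qPoch, norm_prod]
  refine le_trans (by simp) (Finset.prod_le_prod (f := fun _ => 1 - r)
    (fun _ _ => by linarith) fun i _ => ?_)
  have h : ‖a * p ^ i‖ ≤ r := by
    rw [norm_mul, norm_pow]
    exact (mul_le_of_le_one_right (norm_nonneg _) (pow_le_one₀ (norm_nonneg _) hp)).trans ha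
  have := norm_sub_norm_le (1 : ℂ) (a * p ^ i)
  rw [norm_one] at this
  linarith

theorem qPoch_ne_zero {a p : ℂ} (ha : ‖a‖ < 1) (hp : ‖p‖ ≤ 1) (n : ℕ) : qPoch a p n ≠ 0 :=
  norm_pos_iff.1 ((pow_pos (sub_pos.2 ha) n).trans_le (le_norm_qPoch ha.le le_rfl hp n))

theorem norm_pow_lt_one_of_ne_zero {q : ℂ} (hq1 : ‖q‖ < 1) {n : ℕ} (hn : n ≠ 0) : ‖q ^ n‖ < 1 := by
  rw [norm_pow]
  exact pow_lt_one₀ (norm_nonneg _) hq1 hn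

theorem one_sub_pow_ne_zero {q : ℂ} (hq1 : ‖q‖ < 1) {n : ℕ} (hn : n ≠ 0) : 1 - q ^ n ≠ 0 := by
  intro h
  have := norm_pow_lt_one_of_ne_zero hq1 hn
  rw [← sub_eq_zero.1 h, norm_one] at this
  exact lt_irrefl _ this

theorem tendsto_qPoch (a : ℂ) {p : ℂ} (hp : ‖p‖ < 1) :
    Tendsto (qPoch a p) atTop (𝓝 (qPochInf a p)) :=
  (multipliable_qPochInf a hp).hasProd.tendsto_prod_nat

theorem qPochInf_ne_zero {a p : ℂ} (ha : ‖a‖ < 1) (hp : ‖p‖ < 1) : qPochInf a p ≠ 0 := by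
  have hs : Summable fun i : ℕ => ‖-(a * p ^ i)‖ := by
    simp only [norm_neg, norm_mul, norm_pow]
    exact (summable_geometric_of_lt_one (norm_nonneg p) hp).mul_left _
  have h := tprod_one_add_ne_zero_of_summable (f := fun i : ℕ => -(a * p ^ i)) (fun i => by
    rw [← sub_eq_add_neg]
    intro h
    have : ‖a * p ^ i‖ < 1 := by
      rw [norm_mul, norm_pow]
      exact (mul_le_of_le_one_right (norm_nonneg _)
        (pow_le_one₀ (norm_nonneg _) hp.le)).trans_lt ha
    rw [← sub_eq_zero.1 h, norm_one] at this
    exact lt_irrefl _ this) hs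
  simpa only [qPochInf, ← sub_eq_add_neg] using h

/-! ### The deformed terms and their recurrences -/

/-- The term `(a, q, q; q^2)_k / (q^2, a q, a q; q^2)_k * (-1)^k q^(k (k - 1)) a^k` with
`a = q^(2N+1)`.  The very-well-poised factor `1 - a q^(4k)` is left out; for `N = 0` this is
`(-1)^k q^(k^2) (q; q^2)_k^3 / (q^2; q^2)_k^3`. -/
noncomputable def bauerTerm (q : ℂ) (N k : ℕ) : ℂ :=
  (-1) ^ k * q ^ (k ^ 2 + 2 * N * k) *
    (qPoch (q ^ (2 * N + 1)) (q ^ 2) k * qPoch q (q ^ 2) k ^ 2 /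
      (qPoch (q ^ 2) (q ^ 2) k * qPoch (q ^ (2 * N + 2)) (q ^ 2) k ^ 2))

section

variable {q : ℂ}

theorem bauerTerm_succ_right (hq1 : ‖q‖ < 1) (N k : ℕ) :
    bauerTerm q N (k + 1) = -(1 - q ^ (2 * N + 1) * q ^ (2 * k)) * (1 - q * q ^ (2 * k)) ^ 2 *
      q ^ (2 * k) * q ^ (2 * N + 1) /
      ((1 - q ^ 2 * q ^ (2 * k)) * (1 - q ^ (2 * N + 2) * q ^ (2 * k)) ^ 2) * bauerTerm q N k := by
  have hp := norm_pow_lt_one_of_ne_zero hq1 two_ne_zero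
  have h1 := qPoch_ne_zero hp hp.le k
  have h2 := qPoch_ne_zero (norm_pow_lt_one_of_ne_zero hq1 (n := 2 * N + 2) (by omega)) hp.le k
  have h3 := one_sub_pow_ne_zero hq1 (n := 2 + 2 * k) (by omega)
  have h4 := one_sub_pow_ne_zero hq1 (n := 2 * N + 2 + 2 * k) (by omega)
  rw [pow_add _ 2] at h3
  rw [pow_add _ (2 * N + 2)] at h4
  simp only [bauerTerm, qPoch_succ, ← pow_mul]
  field_simp
  ring

theorem bauerTerm_succ_left (hq1 : ‖q‖ < 1) (N k : ℕ) :
    bauerTerm q (N + 1) k = (1 - q ^ (2 * N + 1) * q ^ (2 * k)) * (1 - q ^ (2 * N + 2)) ^ 2 *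
      q ^ (2 * k) / ((1 - q ^ (2 * N + 1)) * (1 - q ^ (2 * N + 2) * q ^ (2 * k)) ^ 2) *
      bauerTerm q N k := by
  have hp := norm_pow_lt_one_of_ne_zero hq1 two_ne_zero
  have h1 := qPoch_ne_zero hp hp.le k
  have h2 := qPoch_ne_zero (norm_pow_lt_one_of_ne_zero hq1 (n := 2 * N + 2) (by omega)) hp.le k
  have h4 := one_sub_pow_ne_zero hq1 (n := 2 * N + 2 + 2 * k) (by omega)
  have h5 := one_sub_pow_ne_zero hq1 (n := 2 * N + 1) (by omega)
  have h6 := one_sub_pow_ne_zero hq1 (n := 2 * N + 2) (by omega)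
  rw [pow_add _ (2 * N + 2)] at h4
  have e1 : qPoch (q ^ (2 * (N + 1) + 1)) (q ^ 2) k =
      qPoch (q ^ (2 * N + 1)) (q ^ 2) k * (1 - q ^ (2 * N + 1) * q ^ (2 * k)) /
        (1 - q ^ (2 * N + 1)) := by
    rw [eq_div_iff h5, pow_mul q 2 k, ← one_sub_mul_qPoch_mul, mul_comm,
      show q ^ (2 * (N + 1) + 1) = q ^ (2 * N + 1) * q ^ 2 by ring]
  have e2 : qPoch (q ^ (2 * (N + 1) + 2)) (q ^ 2) k =
      qPoch (q ^ (2 * N + 2)) (q ^ 2) k * (1 - q ^ (2 * N + 2) * q ^ (2 * k)) /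
        (1 - q ^ (2 * N + 2)) := by
    rw [eq_div_iff h6, pow_mul q 2 k, ← one_sub_mul_qPoch_mul, mul_comm,
      show q ^ (2 * (N + 1) + 2) = q ^ (2 * N + 2) * q ^ 2 by ring]
  simp only [bauerTerm, e1, e2]
  field_simp
  ring

/-- The WZ pair of the deformed series: the recurrence in `N` holds up to a telescoping term. -/
theorem bauerTerm_wz (hq1 : ‖q‖ < 1) (N k : ℕ) :
    (1 - q ^ (2 * N + 1) * (q ^ (2 * k)) ^ 2) * bauerTerm q N k =
      (1 - q ^ (2 * N + 1)) ^ 2 / (1 - q ^ (2 * N + 2)) ^ 2 *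
        ((1 - q ^ (2 * (N + 1) + 1) * (q ^ (2 * k)) ^ 2) * bauerTerm q (N + 1) k) -
      ((1 - q ^ (2 * (k + 1))) * bauerTerm q N (k + 1) - (1 - q ^ (2 * k)) * bauerTerm q N k) := by
  have e1 : q ^ (2 * N + 2) = q ^ (2 * N + 1) * q := by ring
  have h3 := one_sub_pow_ne_zero hq1 (n := 2 * k + 2) (by omega)
  have h4 := one_sub_pow_ne_zero hq1 (n := 2 * N + 1 + 2 * k + 1) (by omega)
  have h5 := one_sub_pow_ne_zero hq1 (n := 2 * N + 1) (by omega)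
  have h6 := one_sub_pow_ne_zero hq1 (n := 2 * N + 2) (by omega)
  rw [pow_add _ _ 2] at h3
  rw [pow_add _ _ 1, pow_add _ _ (2 * k), pow_one] at h4
  rw [e1] at h6
  rw [bauerTerm_succ_left hq1, bauerTerm_succ_right hq1, e1,
    show q ^ (2 * (N + 1) + 1) = q ^ 2 * q ^ (2 * N + 1) by ring,
    show q ^ (2 * (k + 1)) = q ^ 2 * q ^ (2 * k) by ring]
  generalize q ^ (2 * N + 1) = a at *
  generalize q ^ (2 * k) = x at *
  field_simp
  ring

/-! ### Convergence -/

theorem norm_bauerTerm_le (hq1 : ‖q‖ < 1) (N k : ℕ) :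
    ‖bauerTerm q N k‖ ≤ ((2 / (1 - ‖q‖)) ^ 3) ^ k * ‖q‖ ^ (k ^ 2) * (‖q‖ ^ (2 * k)) ^ N := by
  have hr : 0 < 1 - ‖q‖ := sub_pos.2 hq1
  have hp := norm_pow_lt_one_of_ne_zero hq1 two_ne_zero
  have hpow (n : ℕ) : ‖q ^ (n + 1)‖ ≤ ‖q‖ := by
    rw [norm_pow]
    exact pow_le_of_le_one (norm_nonneg _) hq1.le (by omega)
  have n1 := norm_qPoch_le ((hpow (2 * N)).trans hq1.le) hp.le k
  have n2 := norm_qPoch_le hq1.le hp.le k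
  have d1 := le_norm_qPoch hq1.le (hpow 1) hp.le k
  have d2 := le_norm_qPoch hq1.le (hpow (2 * N + 1)) hp.le k
  have hd : 0 < (1 - ‖q‖) ^ k := pow_pos hr k
  rw [bauerTerm, norm_mul, norm_mul, norm_div, norm_mul, norm_mul]
  simp only [norm_pow, norm_neg, norm_one, one_pow, one_mul] at *
  calc _ ≤ ‖q‖ ^ (k ^ 2 + 2 * N * k) *
        (2 ^ k * (2 ^ k) ^ 2 / ((1 - ‖q‖) ^ k * ((1 - ‖q‖) ^ k) ^ 2)) := by
        gcongr
    _ = _ := by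
        simp only [div_pow, ← pow_mul]
        field_simp
        ring

/-- The Gaussian factor makes the series summable whatever the geometric factor. -/
theorem summable_pow_mul_pow_sq {M r : ℝ} (hM : 0 < M) (hr : 0 < r) (hr1 : r < 1) :
    Summable fun k : ℕ => M ^ k * r ^ (k ^ 2) := by
  refine summable_of_ratio_test_tendsto_lt_one zero_lt_one
    (Eventually.of_forall fun k => by positivity) ?_
  have h : Tendsto (fun k : ℕ => M * r * (r ^ 2) ^ k) atTop (𝓝 (M * r * 0)) :=
    (tendsto_pow_atTop_nhds_zero_of_lt_one (by positivity)
      (pow_lt_one₀ hr.le hr1 two_ne_zero)).const_mul _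
  rw [mul_zero] at h
  refine h.congr fun k => ?_
  rw [Real.norm_of_nonneg (by positivity), Real.norm_of_nonneg (by positivity), eq_div_iff
    (by positivity)]
  ring

theorem summable_bauerBound (hq0 : q ≠ 0) (hq1 : ‖q‖ < 1) :
    Summable fun k : ℕ => ((2 / (1 - ‖q‖)) ^ 3) ^ k * ‖q‖ ^ (k ^ 2) :=
  summable_pow_mul_pow_sq (pow_pos (div_pos two_pos (sub_pos.2 hq1)) 3) (norm_pos_iff.2 hq0) hq1

theorem norm_bauerTerm_le_bound (hq1 : ‖q‖ < 1) (N k : ℕ) :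
    ‖bauerTerm q N k‖ ≤ ((2 / (1 - ‖q‖)) ^ 3) ^ k * ‖q‖ ^ (k ^ 2) := by
  have hr : 0 < 1 - ‖q‖ := sub_pos.2 hq1
  exact (norm_bauerTerm_le hq1 N k).trans (mul_le_of_le_one_right (by positivity)
    (pow_le_one₀ (by positivity) (pow_le_one₀ (norm_nonneg _) hq1.le)))

theorem summable_mul_bauerTerm (hq0 : q ≠ 0) (hq1 : ‖q‖ < 1) (N : ℕ) {f : ℕ → ℂ} {C : ℝ}
    (hf : ∀ k, ‖f k‖ ≤ C) : Summable fun k => f k * bauerTerm q N k := by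
  refine Summable.of_norm_bounded ((summable_bauerBound hq0 hq1).mul_left C) fun k => ?_
  rw [norm_mul]
  exact mul_le_mul (hf k) (norm_bauerTerm_le_bound hq1 N k) (norm_nonneg _)
    ((norm_nonneg _).trans (hf k))

theorem norm_one_sub_le_two {z : ℂ} (hz : ‖z‖ ≤ 1) : ‖1 - z‖ ≤ 2 := by
  have := norm_sub_le (1 : ℂ) z
  rw [norm_one] at this
  linarith

theorem norm_one_sub_pow_mul_le (hq1 : ‖q‖ < 1) (n k : ℕ) :
    ‖1 - q ^ n * (q ^ (2 * k)) ^ 2‖ ≤ 2 := by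
  refine norm_one_sub_le_two ?_
  rw [← pow_mul, ← pow_add, norm_pow]
  exact pow_le_one₀ (norm_nonneg _) hq1.le

theorem norm_one_sub_pow_le (hq1 : ‖q‖ < 1) (n : ℕ) : ‖1 - q ^ n‖ ≤ 2 := by
  refine norm_one_sub_le_two ?_
  rw [norm_pow]
  exact pow_le_one₀ (norm_nonneg _) hq1.le

theorem hasSum_sub_of_summable {c : ℕ → ℂ} (hc : Summable c) (h0 : c 0 = 0) :
    HasSum (fun k => c (k + 1) - c k) 0 := by
  have h := ((hasSum_nat_add_iff' 1).2 hc.hasSum).sub hc.hasSum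
  simpa [h0] using h

/-! ### The `q`-analogue of Bauer's series -/

/-- The sum of the deformed series with its very-well-poised factor. -/
noncomputable def bauerSum (q : ℂ) (N : ℕ) : ℂ :=
  ∑' k : ℕ, (1 - q ^ (2 * N + 1) * (q ^ (2 * k)) ^ 2) * bauerTerm q N k

theorem hasSum_bauerSum (hq0 : q ≠ 0) (hq1 : ‖q‖ < 1) (N : ℕ) :
    HasSum (fun k : ℕ => (1 - q ^ (2 * N + 1) * (q ^ (2 * k)) ^ 2) * bauerTerm q N k)
      (bauerSum q N) :=
  (summable_mul_bauerTerm hq0 hq1 N (norm_one_sub_pow_mul_le hq1 _)).hasSum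

theorem bauerSum_eq_succ (hq0 : q ≠ 0) (hq1 : ‖q‖ < 1) (N : ℕ) :
    bauerSum q N =
      (1 - q ^ (2 * N + 1)) ^ 2 / (1 - q ^ (2 * N + 2)) ^ 2 * bauerSum q (N + 1) := by
  have ht := hasSum_sub_of_summable
    (summable_mul_bauerTerm hq0 hq1 N fun k => norm_one_sub_pow_le hq1 (2 * k)) (by simp)
  have h := ((hasSum_bauerSum hq0 hq1 (N + 1)).mul_left
    ((1 - q ^ (2 * N + 1)) ^ 2 / (1 - q ^ (2 * N + 2)) ^ 2)).sub ht
  rw [sub_zero] at h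
  refine (hasSum_bauerSum hq0 hq1 N).unique (h.congr_fun fun k => ?_)
  exact bauerTerm_wz hq1 N k

theorem qPoch_sq_mul_bauerSum_zero (hq0 : q ≠ 0) (hq1 : ‖q‖ < 1) (N : ℕ) :
    qPoch (q ^ 2) (q ^ 2) N ^ 2 * bauerSum q 0 = qPoch q (q ^ 2) N ^ 2 * bauerSum q N := by
  induction N with
  | zero => simp [qPoch]
  | succ N ih =>
    have h6 := one_sub_pow_ne_zero hq1 (n := 2 * N + 2) (by omega)
    rw [qPoch_succ, qPoch_succ, mul_pow, mul_right_comm, ih, bauerSum_eq_succ hq0 hq1 N,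
      show q ^ 2 * (q ^ 2) ^ N = q ^ (2 * N + 2) by ring,
      show q * (q ^ 2) ^ N = q ^ (2 * N + 1) by ring]
    field_simp

theorem tendsto_bauerSum (hq0 : q ≠ 0) (hq1 : ‖q‖ < 1) :
    Tendsto (bauerSum q) atTop (𝓝 1) := by
  have hlim : Tendsto (bauerSum q) atTop (𝓝 (∑' k : ℕ, if k = 0 then (1 : ℂ) else 0)) := by
    refine tendsto_tsum_of_dominated_convergence ((summable_bauerBound hq0 hq1).mul_left 2)
      (fun k => ?_) (Eventually.of_forall fun N k => ?_)
    · split_ifs with hk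
      · subst hk
        have h : Tendsto (fun N : ℕ => 1 - q * (q ^ 2) ^ N) atTop (𝓝 (1 - q * 0)) :=
          ((tendsto_pow_atTop_nhds_zero_of_norm_lt_one
            (norm_pow_lt_one_of_ne_zero hq1 two_ne_zero)).const_mul q).const_sub 1
        rw [mul_zero, sub_zero] at h
        refine h.congr fun N => ?_
        simp [bauerTerm, qPoch]
        ring
      · have h : Tendsto (fun N : ℕ => 2 * (((2 / (1 - ‖q‖)) ^ 3) ^ k * ‖q‖ ^ (k ^ 2) *
            (‖q‖ ^ (2 * k)) ^ N)) atTop (𝓝 (2 * (((2 / (1 - ‖q‖)) ^ 3) ^ k * ‖q‖ ^ (k ^ 2) * 0))) :=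
          ((tendsto_pow_atTop_nhds_zero_of_lt_one (by positivity)
            (pow_lt_one₀ (norm_nonneg _) hq1 (by omega))).const_mul _).const_mul _
        rw [mul_zero, mul_zero] at h
        refine squeeze_zero_norm (fun N => ?_) h
        rw [norm_mul]
        exact mul_le_mul (norm_one_sub_pow_mul_le hq1 _ k) (norm_bauerTerm_le hq1 N k)
          (norm_nonneg _) two_pos.le
    · rw [norm_mul]
      exact mul_le_mul (norm_one_sub_pow_mul_le hq1 _ k) (norm_bauerTerm_le_bound hq1 N k)
        (norm_nonneg _) two_pos.le
  simpa using hlim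

theorem bauerSum_zero (hq0 : q ≠ 0) (hq1 : ‖q‖ < 1) :
    bauerSum q 0 = (1 - q) *
      (qPochInf q (q ^ 2) * qPochInf (q ^ 3) (q ^ 2) / qPochInf (q ^ 2) (q ^ 2) ^ 2) := by
  have hp := norm_pow_lt_one_of_ne_zero hq1 two_ne_zero
  have hne := qPochInf_ne_zero hp hp
  have h : qPochInf (q ^ 2) (q ^ 2) ^ 2 * bauerSum q 0 = qPochInf q (q ^ 2) ^ 2 * 1 :=
    tendsto_nhds_unique
      ((((tendsto_qPoch (q ^ 2) hp).pow 2).mul_const _).congr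
        (qPoch_sq_mul_bauerSum_zero hq0 hq1))
      (((tendsto_qPoch q hp).pow 2).mul (tendsto_bauerSum hq0 hq1))
  have hs : (1 - q) * qPochInf (q ^ 3) (q ^ 2) = qPochInf q (q ^ 2) := by
    have := qPoch_mul_qPochInf q hp 1
    simpa [qPoch, ← pow_succ'] using this
  rw [mul_one, mul_comm, ← eq_div_iff (pow_ne_zero 2 hne)] at h
  rw [h, sq (qPochInf q _)]
  nth_rewrite 2 [← hs]
  ring

/-! ### The two telescoped series -/

/-- `q - q^(2k)` is bounded away from zero, because `2k ≠ 1`. -/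
theorem le_norm_sub_pow_two_mul (hq1 : ‖q‖ < 1) (k : ℕ) :
    ‖q‖ * (1 - ‖q‖) ≤ ‖q - q ^ (2 * k)‖ := by
  rcases k with _ | k
  · have := norm_sub_norm_le 1 q
    rw [norm_one] at this
    rw [mul_zero, pow_zero, norm_sub_rev]
    nlinarith [norm_nonneg q]
  · rw [show q - q ^ (2 * (k + 1)) = q * (1 - q ^ (2 * k + 1)) by ring, norm_mul]
    gcongr
    have := norm_sub_norm_le 1 (q ^ (2 * k + 1))
    rw [norm_one, norm_pow] at this
    have h : ‖q‖ ^ (2 * k + 1) ≤ ‖q‖ := pow_le_of_le_one (norm_nonneg _) hq1.le (by omega)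
    linarith

theorem bauerTerm_zero_left (q : ℂ) (k : ℕ) :
    bauerTerm q 0 k =
      (-1) ^ k * q ^ (k ^ 2) * (qPoch q (q ^ 2) k ^ 3 / qPoch (q ^ 2) (q ^ 2) k ^ 3) := by
  simp only [bauerTerm, mul_zero, zero_mul, add_zero, zero_add, pow_one]
  ring

end

theorem mainTheorem6 (q : ℂ) (hq0 : q ≠ 0) (hq1 : ‖q‖ < 1) :
    HasSum
      (fun k : ℕ =>
        (-1) ^ k * q ^ (k ^ 2 + 2 * k) *
          (qInt q (4 * k + 1) / ((qInt q (2 * k) - 1) * qInt q (2 * k + 2))) *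
          (qPoch q (q ^ 2) k ^ 3 / qPoch (q ^ 2) (q ^ 2) k ^ 3))
      (-(qPochInf q (q ^ 2) * qPochInf (q ^ 3) (q ^ 2) / qPochInf (q ^ 2) (q ^ 2) ^ 2)) ∧
    HasSum
      (fun k : ℕ =>
        (-1) ^ k * q ^ (k ^ 2) *
          (bauerP q (q ^ (2 * k)) / ((1 - q) ^ 2 * qInt q (2 * k + 2) ^ 2)) *
          (qPoch q (q ^ 2) k ^ 3 / qPoch (q ^ 2) (q ^ 2) k ^ 3))
      (qPochInf q (q ^ 2) * qPochInf (q ^ 3) (q ^ 2) / qPochInf (q ^ 2) (q ^ 2) ^ 2) := by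
  have hq : 1 - q ≠ 0 := by simpa using one_sub_pow_ne_zero hq1 one_ne_zero
  have hr : 0 < ‖q‖ * (1 - ‖q‖) := mul_pos (norm_pos_iff.2 hq0) (sub_pos.2 hq1)
  have hsub (k : ℕ) : q - q ^ (2 * k) ≠ 0 :=
    norm_pos_iff.1 (hr.trans_le (le_norm_sub_pow_two_mul hq1 k))
  have hbase := hasSum_bauerSum hq0 hq1 0
  rw [bauerSum_zero hq0 hq1] at hbase
  constructor
  · have ht := hasSum_sub_of_summable (summable_mul_bauerTerm hq0 hq1 0
      (f := fun k => (1 - q ^ (2 * k)) ^ 2 / (q - q ^ (2 * k)))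
      (C := 2 ^ 2 / (‖q‖ * (1 - ‖q‖))) fun k => by
        rw [norm_div, norm_pow]
        gcongr
        · exact norm_one_sub_pow_le hq1 _
        · exact le_norm_sub_pow_two_mul hq1 k) (by simp)
    have h := (hbase.add (ht.mul_left q)).mul_left (-(1 - q)⁻¹)
    rw [mul_zero q, add_zero (_ * _), neg_mul, inv_mul_cancel_left₀ hq] at h
    refine h.congr_fun fun k => ?_
    have h1 := one_sub_pow_ne_zero hq1 (n := 2 * k + 2) (by omega)
    have h2 := hsub k
    have h3 := hsub (k + 1)
    have h4 : qInt q (2 * k) - 1 = (q - q ^ (2 * k)) / (1 - q) := by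
      rw [qInt]
      field_simp
      ring
    -- the denominator `q - q^(2k+2)` cancels against a factor `1 - q^(2k+1)` of the next term
    have h5 := one_sub_pow_ne_zero hq1 (n := 2 * k + 1) (by omega)
    have h6 : q - q ^ (2 * (k + 1)) = q * (1 - q ^ (2 * k) * q) := by ring
    rw [pow_add _ _ 1, pow_one] at h5
    rw [pow_add _ _ 2] at h1
    have h7 : bauerTerm q 0 k * q ^ (2 * k) = (-1) ^ k * q ^ (k ^ 2 + 2 * k) *
        (qPoch q (q ^ 2) k ^ 3 / qPoch (q ^ 2) (q ^ 2) k ^ 3) := by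
      rw [bauerTerm_zero_left]
      ring
    rw [mul_right_comm, ← h7, bauerTerm_succ_right hq1, h4, h6, qInt, qInt,
      show q ^ (2 * k + 2) = q ^ (2 * k) * q ^ 2 by ring,
      show q ^ (4 * k + 1) = q * (q ^ (2 * k)) ^ 2 by ring,
      show q ^ (2 * (k + 1)) = q ^ (2 * k) * q ^ 2 by ring]
    simp only [mul_zero, zero_add, pow_one]
    generalize q ^ (2 * k) = x at *
    field_simp
    ring
  · have ht := hasSum_sub_of_summable
      (summable_mul_bauerTerm hq0 hq1 0 fun k => norm_one_sub_pow_le hq1 (2 * k)) (by simp)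
    have h := (hbase.add (ht.mul_left q)).mul_left (1 - q)⁻¹
    rw [mul_zero q, add_zero (_ * _), inv_mul_cancel_left₀ hq] at h
    refine h.congr_fun fun k => ?_
    have h1 := one_sub_pow_ne_zero hq1 (n := 2 + 2 * k) (by omega)
    rw [pow_add _ 2] at h1
    rw [mul_right_comm, ← bauerTerm_zero_left, bauerTerm_succ_right hq1, qInt, bauerP,
      show q ^ (2 * k + 2) = q ^ 2 * q ^ (2 * k) by ring,
      show q ^ (2 * (k + 1)) = q ^ 2 * q ^ (2 * k) by ring]
    simp only [mul_zero, zero_add, pow_one]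
    generalize q ^ (2 * k) = x at *
    field_simp
    ring
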